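/- Let $N\ge 1$, let $\Omega\subset\mathbb R^N$ be a bounded domain, let $d>0$, $v\in\mathbb R^N$, $0<T<\infty$, and let $\mathcal L:L^2(\Omega)\to L^2(\Omega)$, $\mathcal L u_0=u(\cdot,T)$, be the solution operator of $$\partial_t u-d\Delta u+v\cdot\nabla u=0 \text{ in }\Omega\times(0,T),\qquad u=0\text{ on }\partial\Omega\times(0,T),\qquad u(\cdot,0)=u_0 .$$ Let $\tau,\beta>0$, $u_T\in L^2(\Omega)$, and put $f(q)=\frac12\int_\Omega|q-u_T|^2dx$, $g(u_0)=\frac\tau2\int_\Omega|u_0|^2dx+\beta\int_\Omega|u_0|dx$, $f^*(p)=\sup_{q\in L^2(\Omega)}\big(\int_\Omega pq\,dx-f(q)\big)$. Let $w^*=(u_0^*,p^*)$ be a solution (saddle point) of $$\min_{u_0\in L^2(\Omega)}\max_{p\in L^2(\Omega)}\Big(g(u_0)+\int_\Omega p\,\mathcal L u_0\,dx-f^*(p)\Big).$$ Let $\theta\in(0,1]$ and $r,s>0$ with $rs<1/\|\mathcal L\mathcal L^*\|$, and let $\rho,\sigma$ satisfy $\rho=\sigma\in(0,2)$ if $\theta=1$,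 and $\rho\in\big(0,1+\theta-\sqrt{1-\theta}\,\big]$, $\sigma=\rho/\theta$ if $\theta\in(0,1)$. From arbitrary initial values $u_0^0,p^0\in L^2(\Omega)$, Algorithm 1 generates $w^k=(u_0^k,p^k)$ and $\widetilde w^k=(\widetilde u_0^k,\widetilde p^{\,k})$, $k\ge 0$, by $$\widetilde u_0^k=\arg\min_{u_0\in L^2(\Omega)}\Big(g(u_0)+\int_\Omega p^k\mathcal L u_0\,dx+\tfrac1{2r}\|u_0-u_0^k\|_{L^2(\Omega)}^2\Big),\qquad \bar u_0^k=\widetilde u_0^k+\theta(\widetilde u_0^k-u_0^k),$$ $$\widetilde p^{\,k}=\arg\max_{p\in L^2(\Omega)}\Big(\int_\Omega p\,\mathcal L\bar u_0^k\,dx-f^*(p)-\tfrac1{2s}\|p-p^k\|_{L^2(\Omega)}^2\Big),$$ $$u_0^{k+1}=u_0^k-\rho(u_0^k-\widetilde u_0^k),\qquad p^{k+1}=p^k-\sigma(p^k-\widetilde p^{\,k}).$$ On $L^2(\Omega)\times L^2(\Omega)$ define $$\mathcal D=\begin{pmatrix}\rho I&0\\0&\sigma I\end{pmatrix},\quad G=\begin{pmatrix}\frac1r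 I&-\mathcal L^*\\-\theta\mathcal L&\frac1s I\end{pmatrix},\quad \mathcal K=G\mathcal D^{-1},\quad \|w\|_{\mathcal K}^2=(\mathcal K w,w).$$ Then there is a constant $c_0>0$, depending only on $\mathcal L,\theta,r,s,\rho,\sigma$ (so not on $\tau,\beta,u_T$, the initial values, $w^*$ or $K$), such that the sequence $K\mapsto\|\mathcal D(w^K-\widetilde w^K)\|_{\mathcal K}^2$, $K\ge 0$, is non-increasing and $$\|\mathcal D(w^K-\widetilde w^K)\|_{\mathcal K}^2\le\frac{1}{c_0(K+1)}\|w^0-w^*\|_{\mathcal K}^2\qquad\text{for all } K\in\mathbb N .$$ In particular $\|\mathcal D(w^K-\widetilde w^K)\|_{\mathcal K}^2=O(1/K)$ as $K\to\infty$. -/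

import Mathlib

open scoped ContDiff
open MeasureTheory Filter Topology

namespace SourceId

/-- `ℝ^N` with its Euclidean norm. -/
abbrev Space (N : ℕ) : Type := EuclideanSpace ℝ (Fin N)

/-- `L²(Ω)`, real-valued. -/
abbrev L2 {N : ℕ} (Ω : Set (Space N)) : Type :=
  Lp ℝ 2 ((volume : Measure (Space N)).restrict Ω)

/-- `L²(Ω; ℝ^N)`, square-integrable vector fields. -/
abbrev L2Vec {N : ℕ} (Ω : Set (Space N)) : Type :=
  Lp (Space N) 2 ((volume : Measure (Space N)).restrict Ω)

section PDE

variable {N : ℕ}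

/-- `u ∈ H¹₀(Ω)` with weak gradient `Du`: the pair `(u, Du)` is the limit in
`L²(Ω) × L²(Ω; ℝ^N)` of pairs `(φ, ∇φ)` with `φ ∈ C_c^∞(Ω)`. -/
def IsH10 (Ω : Set (Space N)) (u : L2 Ω) (Du : L2Vec Ω) : Prop :=
  ∃ φ : ℕ → Space N → ℝ,
    (∀ n, ContDiff ℝ ∞ (φ n) ∧ HasCompactSupport (φ n) ∧ tsupport (φ n) ⊆ Ω) ∧
    Tendsto (fun n => eLpNorm (fun x => φ n x - u x) 2 (volume.restrict Ω)) atTop (𝓝 0) ∧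
    Tendsto (fun n => eLpNorm (fun x => gradient (φ n) x - Du x) 2 (volume.restrict Ω))
      atTop (𝓝 0)

/-- `u` (with spatial gradient `Du`) is the weak solution on `Ω × (0, T)` of
`∂ₜu - d Δu + v · ∇u = 0`, `u = 0` on `∂Ω × (0, T)`, `u(·, 0) = u₀`:
`u ∈ C([0, T]; L²(Ω)) ∩ L²(0, T; H¹₀(Ω))`, and for every `φ ∈ H¹₀(Ω)` the equation
`d/dt (u, φ) + d (∇u, ∇φ) + (v · ∇u, φ) = 0` holds, integrated over `(0, t)`. -/
structure IsWeakSolution (Ω : Set (Space N)) (d : ℝ) (v : Space N) (T : ℝ) (u₀ : L2 Ω)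
    (u : ℝ → L2 Ω) (Du : ℝ → L2Vec Ω) : Prop where
  continuousOn : ContinuousOn u (Set.Icc 0 T)
  initial : u 0 = u₀
  memLp_gradient : MemLp Du 2 ((volume : Measure ℝ).restrict (Set.Ioo 0 T))
  isH10 : ∀ᵐ t ∂((volume : Measure ℝ).restrict (Set.Ioo 0 T)), IsH10 Ω (u t) (Du t)
  equation : ∀ (φ : L2 Ω) (Dφ : L2Vec Ω), IsH10 Ω φ Dφ → ∀ t ∈ Set.Icc 0 T,
    inner ℝ (u t) φ - inner ℝ u₀ φ
      + (∫ s in (0 : ℝ)..t, (d * inner ℝ (Du s) Dφ + ∫ x in Ω, inner ℝ v (Du s x) * φ x)) = 0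

/-- `L` maps every initial datum `u₀ ∈ L²(Ω)` to the final state `u(·, T)`. -/
def IsSolutionOperator (Ω : Set (Space N)) (d : ℝ) (v : Space N) (T : ℝ)
    (L : L2 Ω →L[ℝ] L2 Ω) : Prop :=
  ∀ u₀ : L2 Ω, ∃ (u : ℝ → L2 Ω) (Du : ℝ → L2Vec Ω),
    IsWeakSolution Ω d v T u₀ u Du ∧ L u₀ = u T

open Classical in
/-- The solution operator `𝓛 u₀ = u(·, T)` of the diffusion-advection equation, a bounded linear
operator on `L²(Ω)`. For a bounded domain `Ω`, `d > 0` and `T > 0` it exists and is unique (the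
equation is well-posed); outside that range the value `0` is a placeholder. -/
noncomputable def solutionOperator (Ω : Set (Space N)) (d : ℝ) (v : Space N) (T : ℝ) :
    L2 Ω →L[ℝ] L2 Ω :=
  if h : ∃ L : L2 Ω →L[ℝ] L2 Ω, IsSolutionOperator Ω d v T L then h.choose else 0

end PDE

section SaddlePoint

variable {N : ℕ} {Ω : Set (Space N)}

/-- `f(q) = ½ ∫_Ω |q - u_T|² dx`. -/
noncomputable def fidelity (uT q : L2 Ω) : ℝ := 1 / 2 * ∫ x in Ω, |q x - uT x| ^ 2

/-- `g(u₀) = (τ/2) ∫_Ω |u₀|² dx + β ∫_Ω |u₀| dx`. -/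
noncomputable def regularizer (τ β : ℝ) (u : L2 Ω) : ℝ :=
  τ / 2 * (∫ x in Ω, |u x| ^ 2) + β * ∫ x in Ω, |u x|

/-- The convex conjugate `f*(p) = sup_q (∫_Ω p q dx - f(q))`; the supremum is finite. -/
noncomputable def fidelityConj (uT p : L2 Ω) : ℝ :=
  ⨆ q : L2 Ω, ((∫ x in Ω, p x * q x) - fidelity uT q)

/-- The saddle function `g(u₀) + ∫_Ω p 𝓛u₀ dx - f*(p)`. -/
noncomputable def lagrangian (L : L2 Ω →L[ℝ] L2 Ω) (τ β : ℝ) (uT u p : L2 Ω) : ℝ :=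
  regularizer τ β u + (∫ x in Ω, p x * L u x) - fidelityConj uT p

/-- `(u⋆, p⋆)` solves `min_u max_p lagrangian`, i.e. it is a saddle point. -/
def IsSaddleSolution (L : L2 Ω →L[ℝ] L2 Ω) (τ β : ℝ) (uT us ps : L2 Ω) : Prop :=
  IsSaddlePointOn Set.univ Set.univ (lagrangian L τ β uT) us ps

/-- The admissible parameters of the algorithm. The step size condition is
`r s < 1 / ‖𝓛𝓛*‖`, written without division. -/
structure Admissible (L : L2 Ω →L[ℝ] L2 Ω) (θ r s ρ σ : ℝ) : Prop where
  theta_pos : 0 < θ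
  theta_le_one : θ ≤ 1
  r_pos : 0 < r
  s_pos : 0 < s
  step : r * s * ‖L ∘L ContinuousLinearMap.adjoint L‖ < 1
  relax_one : θ = 1 → ρ = σ ∧ ρ ∈ Set.Ioo (0 : ℝ) 2
  relax_lt_one : θ < 1 → ρ ∈ Set.Ioc 0 (1 + θ - √(1 - θ)) ∧ σ = ρ / θ

/-- The sequences `u^k, p^k` (iterates) and `ũ^k, p̃^k` (predictors) are generated by the generalized
primal-dual algorithm, from the initial values `u 0` and `p 0`. -/
structure IsGenerated (L : L2 Ω →L[ℝ] L2 Ω) (τ β : ℝ) (uT : L2 Ω) (θ r s ρ σ : ℝ)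
    (u p u' p' : ℕ → L2 Ω) : Prop where
  predict_u : ∀ k, IsMinOn
    (fun z : L2 Ω => regularizer τ β z + (∫ x in Ω, p k x * L z x)
      + 1 / (2 * r) * ‖z - u k‖ ^ 2) Set.univ (u' k)
  predict_p : ∀ k, IsMaxOn
    (fun q : L2 Ω => (∫ x in Ω, q x * L (u' k + θ • (u' k - u k)) x) - fidelityConj uT q
      - 1 / (2 * s) * ‖q - p k‖ ^ 2) Set.univ (p' k)
  correct_u : ∀ k, u (k + 1) = u k - ρ • (u k - u' k)
  correct_p : ∀ k, p (k + 1) = p k - σ • (p k - p' k)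

end SaddlePoint

section Operators

variable {H : Type*} [NormedAddCommGroup H] [InnerProductSpace ℝ H]

/-- The Hilbert space `W = H × H`, with `(w₁, w₂) = (u₁, u₂) + (p₁, p₂)`. -/
abbrev W (H : Type*) [NormedAddCommGroup H] : Type _ := WithLp 2 (H × H)

/-- The element `(u, p)` of `W`. -/
def pair (u p : H) : W H := WithLp.toLp 2 (u, p)

/-- The operator on `W` given by the block matrix with rows `(A, B)` and `(C, E)`. -/
noncomputable def blockOp (A B C E : H →L[ℝ] H) : W H →L[ℝ] W H :=
  ((WithLp.prodContinuousLinearEquiv 2 ℝ H H).symm : H × H →L[ℝ] W H) ∘L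
    ((A.coprod B).prod (C.coprod E)) ∘L
    ((WithLp.prodContinuousLinearEquiv 2 ℝ H H) : W H →L[ℝ] H × H)

/-- `𝓓 = diag(ρ I, σ I)`. -/
noncomputable def opD (H : Type*) [NormedAddCommGroup H] [InnerProductSpace ℝ H] (ρ σ : ℝ) :
    W H →L[ℝ] W H :=
  blockOp (ρ • ContinuousLinearMap.id ℝ H) 0 0 (σ • ContinuousLinearMap.id ℝ H)

/-- `G` has rows `((1/r) I, -𝓛*)` and `(-θ 𝓛, (1/s) I)`. -/
noncomputable def opG [CompleteSpace H] (L : H →L[ℝ] H) (θ r s : ℝ) : W H →L[ℝ] W H :=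
  blockOp ((1 / r) • ContinuousLinearMap.id ℝ H) (-ContinuousLinearMap.adjoint L)
    (-(θ • L)) ((1 / s) • ContinuousLinearMap.id ℝ H)

/-- `𝓚 = G 𝓓⁻¹`. -/
noncomputable def opK [CompleteSpace H] (L : H →L[ℝ] H) (θ r s ρ σ : ℝ) : W H →L[ℝ] W H :=
  opG L θ r s ∘L (opD H ρ σ).inverse

/-- The square `‖w‖²_A = (A w, w)` of the norm induced by a self-adjoint positive definite `A`. -/
noncomputable def normSq (A : W H →L[ℝ] W H) (w : W H) : ℝ := inner ℝ (A w) w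

/-- The residual `‖𝓓(w - w̃)‖²_𝓚` of `w = (u, p)` and `w̃ = (u', p')`. -/
noncomputable def residual [CompleteSpace H] (L : H →L[ℝ] H) (θ r s ρ σ : ℝ)
    (u p u' p' : H) : ℝ :=
  normSq (opK L θ r s ρ σ) (opD H ρ σ (pair u p - pair u' p'))

end Operators

end SourceId

/-! Write `e = w - w̃`. The optimality conditions of the two proximal steps merge into one
variational inequality governed by `G e` (`IsGenerated.variational`). Tested with the saddle point
it gives `(G e, w̃ - w*) ≥ 0`; tested at two consecutive steps with each other's predictors it gives
the same kind of sign for the difference of the errors.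

The parameter rules do two things. The relation `θ σ = ρ` makes `𝓚 = G 𝓓⁻¹` symmetric, so `‖·‖²_𝓚`
expands like a squared norm. The bounds on `ρ` and `r s` make `2 (G e, e) - ‖𝓓 e‖²_𝓚` coercive,
hence at least `c ‖𝓓 e‖²_𝓚` (`Admissible.exists_contraction_constant`); this `c` is the constant of
the theorem.

Consequently `‖w - w*‖²_𝓚` drops by at least `c ‖𝓓 e‖²_𝓚` per step, while `‖𝓓 e‖²_𝓚` itself never
grows. Telescoping gives the rate. -/

namespace SourceId

/-! ### Block operators on `H × H` -/

section Blocks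

theorem exists_eq_pair {H : Type*} [NormedAddCommGroup H] (w : W H) :
    ∃ u p : H, w = pair u p := ⟨w.fst, w.snd, rfl⟩

theorem pair_sub {H : Type*} [NormedAddCommGroup H] (u p u' p' : H) :
    pair u p - pair u' p' = pair (u - u') (p - p') := rfl

variable {H : Type*} [NormedAddCommGroup H] [InnerProductSpace ℝ H]

theorem blockOp_pair (A B C E : H →L[ℝ] H) (u p : H) :
    blockOp A B C E (pair u p) = pair (A u + B p) (C u + E p) := rfl

theorem inner_pair (u p u' p' : H) :
    inner ℝ (pair u p) (pair u' p') = inner ℝ u u' + inner ℝ p p' :=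
  WithLp.prod_inner_apply _ _

theorem norm_sq_pair (u p : H) : ‖pair u p‖ ^ 2 = ‖u‖ ^ 2 + ‖p‖ ^ 2 := by
  rw [← real_inner_self_eq_norm_sq, inner_pair, real_inner_self_eq_norm_sq,
    real_inner_self_eq_norm_sq]

theorem opD_pair (ρ σ : ℝ) (u p : H) : opD H ρ σ (pair u p) = pair (ρ • u) (σ • p) := by
  simp [opD, blockOp_pair]

theorem opD_inverse {ρ σ : ℝ} (hρ : ρ ≠ 0) (hσ : σ ≠ 0) :
    (opD H ρ σ).inverse = opD H ρ⁻¹ σ⁻¹ := by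
  apply ContinuousLinearMap.inverse_eq
  all_goals
    ext1 w
    obtain ⟨u, p, rfl⟩ := exists_eq_pair w
    simp [opD_pair, smul_smul, hρ, hσ]

/-- A two-by-two quadratic form with dominating diagonal is coercive. -/
theorem exists_coercive (L : H →L[ℝ] H) {a b c : ℝ} (ha : 0 < a) (hc : 0 < c)
    (h : b ^ 2 * ‖L‖ ^ 2 < a * c) :
    ∃ m : ℝ, 0 < m ∧ ∀ u p : H, m * (‖u‖ ^ 2 + ‖p‖ ^ 2) ≤
      a * ‖u‖ ^ 2 - 2 * b * inner ℝ (L u) p + c * ‖p‖ ^ 2 := by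
  have hac : 0 < a + c := by positivity
  -- Determinant over trace, a lower bound for the smaller eigenvalue of the matrix with diagonal
  -- `a`, `c` and off-diagonal `|b| ‖L‖`; subtracting it leaves determinant `m ^ 2 ≥ 0`.
  set m := (a * c - b ^ 2 * ‖L‖ ^ 2) / (a + c) with hm
  have hmul : m * (a + c) = a * c - b ^ 2 * ‖L‖ ^ 2 := div_mul_cancel₀ _ hac.ne'
  have hm0 : 0 < m := div_pos (by linarith) hac
  have hma : m < a := by
    rw [hm, div_lt_iff₀ hac]; nlinarith [sq_nonneg (b * ‖L‖), mul_pos ha ha]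
  have hmc : m < c := by
    rw [hm, div_lt_iff₀ hac]; nlinarith [sq_nonneg (b * ‖L‖), mul_pos hc hc]
  refine ⟨m, hm0, fun u p => ?_⟩
  have hcs : |inner ℝ (L u) p| ≤ ‖L‖ * ‖u‖ * ‖p‖ :=
    (abs_real_inner_le_norm _ _).trans
      (mul_le_mul_of_nonneg_right (L.le_opNorm u) (norm_nonneg p))
  have hcross : b * inner ℝ (L u) p ≤ |b| * ‖L‖ * ‖u‖ * ‖p‖ := by
    calc b * inner ℝ (L u) p ≤ |b| * |inner ℝ (L u) p| := by
          rw [← abs_mul]; exact le_abs_self _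
      _ ≤ |b| * (‖L‖ * ‖u‖ * ‖p‖) := mul_le_mul_of_nonneg_left hcs (abs_nonneg b)
      _ = _ := by ring
  have hdisc : (|b| * ‖L‖) ^ 2 ≤ (a - m) * (c - m) := by
    rw [mul_pow, sq_abs]; nlinarith [sq_nonneg m]
  have hquad : 0 ≤ (a - m) * ‖u‖ ^ 2 - 2 * (|b| * ‖L‖) * ‖u‖ * ‖p‖ + (c - m) * ‖p‖ ^ 2 := by
    refine nonneg_of_mul_nonneg_right (a := a - m) ?_ (sub_pos.2 hma)
    nlinarith [sq_nonneg ((a - m) * ‖u‖ - |b| * ‖L‖ * ‖p‖),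
      mul_le_mul_of_nonneg_right hdisc (sq_nonneg ‖p‖)]
  nlinarith

variable [CompleteSpace H]

theorem opG_pair (L : H →L[ℝ] H) (θ r s : ℝ) (u p : H) :
    opG L θ r s (pair u p) = pair ((1 / r) • u - ContinuousLinearMap.adjoint L p)
      ((1 / s) • p - θ • L u) := by
  rw [opG, blockOp_pair]
  congr 1
  · simp [sub_eq_add_neg]
  · simp [sub_eq_add_neg, add_comm]

theorem opK_comp_opD (L : H →L[ℝ] H) (θ r s : ℝ) {ρ σ : ℝ} (hρ : ρ ≠ 0) (hσ : σ ≠ 0) (w : W H) :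
    opK L θ r s ρ σ (opD H ρ σ w) = opG L θ r s w := by
  obtain ⟨u, p, rfl⟩ := exists_eq_pair w
  simp [opK, opD_inverse hρ hσ, opD_pair, smul_smul, hρ, hσ]

theorem inner_opG_pair (L : H →L[ℝ] H) (θ r s : ℝ) (u p u' p' : H) :
    inner ℝ (opG L θ r s (pair u p)) (pair u' p') =
      1 / r * inner ℝ u u' - inner ℝ (L u') p + 1 / s * inner ℝ p p' - θ * inner ℝ (L u) p' := by
  rw [opG_pair, inner_pair, inner_sub_left, inner_sub_left, inner_smul_left, inner_smul_left,
    inner_smul_left, ContinuousLinearMap.adjoint_inner_left, real_inner_comm p]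
  simp
  ring

/-- The off-diagonal blocks of `𝓚` are `-𝓛*/σ` and `-θ𝓛/ρ`; they are adjoint to each other because
`θ σ = ρ`. -/
theorem inner_opK_comm (L : H →L[ℝ] H) {θ r s ρ σ : ℝ} (hρ : ρ ≠ 0) (hσ : σ ≠ 0)
    (h : θ * σ = ρ) (w w' : W H) :
    inner ℝ (opK L θ r s ρ σ w) w' = inner ℝ (opK L θ r s ρ σ w') w := by
  obtain ⟨u, p, rfl⟩ := exists_eq_pair w
  obtain ⟨u', p', rfl⟩ := exists_eq_pair w'
  subst h
  have hθ : θ ≠ 0 := left_ne_zero_of_mul hρ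
  simp only [opK, opD_inverse hρ hσ, ContinuousLinearMap.comp_apply, opD_pair, inner_opG_pair,
    map_smul, inner_smul_left, inner_smul_right, real_inner_comm u, real_inner_comm p]
  simp
  field_simp
  ring

end Blocks

/-! ### Consequences of the parameter rules -/

section Parameters

variable {N : ℕ} {Ω : Set (Space N)} {L : L2 Ω →L[ℝ] L2 Ω} {θ r s ρ σ : ℝ}

theorem Admissible.step_norm (h : Admissible L θ r s ρ σ) : r * s * ‖L‖ ^ 2 < 1 := by
  have h1 := ContinuousLinearMap.norm_adjoint_comp_self (ContinuousLinearMap.adjoint L)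
  rw [ContinuousLinearMap.adjoint_adjoint, LinearIsometryEquiv.norm_map] at h1
  have h2 := h.step
  rwa [h1, ← sq] at h2

/-- The scalar conditions on the relaxation parameters. -/
theorem Admissible.relaxation (h : Admissible L θ r s ρ σ) :
    0 < ρ ∧ 0 < σ ∧ θ * σ = ρ ∧ ρ < 2 ∧ σ < 2 ∧ (1 + θ - ρ) ^ 2 ≤ (2 - ρ) * (2 - σ) := by
  obtain hθ | hθ := h.theta_le_one.eq_or_lt
  · obtain ⟨rfl, h0, h2⟩ := h.relax_one hθ
    subst hθ
    exact ⟨h0, h0, one_mul _, h2, h2, by nlinarith⟩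
  · obtain ⟨⟨h0, h1⟩, rfl⟩ := h.relax_lt_one hθ
    have hp := h.theta_pos
    have hsq : √(1 - θ) ^ 2 = 1 - θ := Real.sq_sqrt (by linarith)
    have hs0 : 0 < √(1 - θ) := Real.sqrt_pos.2 (by linarith)
    have hs1 : √(1 - θ) < 1 := by nlinarith
    refine ⟨h0, div_pos h0 hp, by field_simp, by linarith, ?_, ?_⟩
    · rw [div_lt_iff₀ hp]; nlinarith
    · have hfac : 0 ≤ (1 + θ - √(1 - θ) - ρ) * (1 + θ + √(1 - θ) - ρ) :=
        mul_nonneg (by linarith) (by linarith)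
      -- This identity explains the upper bound on `ρ`: the right side is nonnegative as soon as `1
      -- + θ - ρ ≥ √(1 - θ)`.
      have hid : (2 - ρ) * (2 - ρ / θ) - (1 + θ - ρ) ^ 2 =
          (1 - θ) / θ * ((1 + θ - ρ) ^ 2 - (1 - θ)) := by
        field_simp; ring
      have : 0 ≤ (1 - θ) / θ * ((1 + θ - ρ) ^ 2 - (1 - θ)) :=
        mul_nonneg (div_nonneg (by linarith) hp.le) (by nlinarith)
      linarith

theorem Admissible.normSq_opK_nonneg (h : Admissible L θ r s ρ σ) (w : W (L2 Ω)) :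
    0 ≤ normSq (opK L θ r s ρ σ) w := by
  obtain ⟨hρ, hσ, hθσ, -, -, -⟩ := h.relaxation
  have hθ := h.theta_pos
  have hr := h.r_pos
  have hs := h.s_pos
  obtain ⟨m, hm, hco⟩ := exists_coercive L (a := 1 / (r * ρ)) (b := 1 / σ) (c := 1 / (s * σ))
    (by positivity) (by positivity) (by
      have h1 : r * s * ‖L‖ ^ 2 * θ < 1 := by
        nlinarith [h.step_norm, h.theta_le_one, mul_nonneg (mul_pos hr hs).le (sq_nonneg ‖L‖)]
      rw [← hθσ]
      calc (1 / σ) ^ 2 * ‖L‖ ^ 2 = (r * s * ‖L‖ ^ 2 * θ) / (r * s * θ * σ ^ 2) := by field_simp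
        _ < 1 / (r * s * θ * σ ^ 2) := by gcongr
        _ = _ := by field_simp)
  obtain ⟨u, p, rfl⟩ := exists_eq_pair w
  have hval : normSq (opK L θ r s ρ σ) (pair u p) = 1 / (r * ρ) * ‖u‖ ^ 2
      - 2 * (1 / σ) * inner ℝ (L u) p + 1 / (s * σ) * ‖p‖ ^ 2 := by
    rw [normSq, opK, opD_inverse hρ.ne' hσ.ne', ContinuousLinearMap.comp_apply, opD_pair,
      inner_opG_pair]
    simp only [map_smul, inner_smul_left, inner_smul_right, real_inner_self_eq_norm_sq]
    simp only [conj_trivial, ← hθσ]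
    field_simp
    ring
  rw [hval]
  exact le_trans (by positivity) (hco u p)

/-- `2 (G e, e) - ‖𝓓 e‖²_𝓚` dominates a multiple of `‖𝓓 e‖²_𝓚`. -/
theorem Admissible.exists_contraction_constant (h : Admissible L θ r s ρ σ) :
    ∃ c : ℝ, 0 < c ∧ ∀ e : W (L2 Ω), c * normSq (opK L θ r s ρ σ) (opD (L2 Ω) ρ σ e) ≤
      2 * inner ℝ (opG L θ r s e) e - normSq (opK L θ r s ρ σ) (opD (L2 Ω) ρ σ e) := by
  obtain ⟨hρ, hσ, hθσ, hρ2, hσ2, hdisc⟩ := h.relaxation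
  have hr := h.r_pos
  have hs := h.s_pos
  have hρ2' : 0 < 2 - ρ := by linarith
  have hσ2' : 0 < 2 - σ := by linarith
  -- These are the coefficients of `2 (G e, e) - (G e, 𝓓 e)`; the cross term is `2(1 + θ) - ρ - θσ =
  -- 2(1 + θ - ρ)`.
  obtain ⟨m, hm, hco⟩ := exists_coercive L (a := (2 - ρ) / r) (b := 1 + θ - ρ) (c := (2 - σ) / s)
    (by positivity) (by positivity) (by
      calc (1 + θ - ρ) ^ 2 * ‖L‖ ^ 2 ≤ (2 - ρ) * (2 - σ) * ‖L‖ ^ 2 := by gcongr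
        _ = (2 - ρ) * (2 - σ) * (r * s * ‖L‖ ^ 2) / (r * s) := by field_simp
        _ < (2 - ρ) * (2 - σ) * 1 / (r * s) := by
          have := h.step_norm
          gcongr
        _ = _ := by field_simp)
  set M := ‖opG L θ r s‖ * ‖opD (L2 Ω) ρ σ‖ + 1 with hM
  have hM0 : 0 < M := by positivity
  refine ⟨m / M, by positivity, fun e => ?_⟩
  have hup : normSq (opK L θ r s ρ σ) (opD (L2 Ω) ρ σ e) ≤ M * ‖e‖ ^ 2 := by
    rw [normSq, opK_comp_opD L θ r s hρ.ne' hσ.ne']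
    calc _ ≤ ‖opG L θ r s e‖ * ‖opD (L2 Ω) ρ σ e‖ := real_inner_le_norm _ _
      _ ≤ (‖opG L θ r s‖ * ‖e‖) * (‖opD (L2 Ω) ρ σ‖ * ‖e‖) := by
        gcongr <;> exact ContinuousLinearMap.le_opNorm _ _
      _ ≤ M * ‖e‖ ^ 2 := by rw [hM]; nlinarith [sq_nonneg ‖e‖]
  have hlow : m * ‖e‖ ^ 2 ≤
      2 * inner ℝ (opG L θ r s e) e - normSq (opK L θ r s ρ σ) (opD (L2 Ω) ρ σ e) := by
    obtain ⟨u, p, rfl⟩ := exists_eq_pair e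
    rw [norm_sq_pair]
    refine (hco u p).trans_eq ?_
    rw [normSq, opK_comp_opD L θ r s hρ.ne' hσ.ne', opD_pair, inner_opG_pair, inner_opG_pair]
    simp only [map_smul, inner_smul_left, inner_smul_right, real_inner_self_eq_norm_sq]
    simp only [conj_trivial, ← hθσ]
    ring
  calc _ ≤ m / M * (M * ‖e‖ ^ 2) := by gcongr
    _ = m * ‖e‖ ^ 2 := by field_simp
    _ ≤ _ := hlow

end Parameters

/-! ### Abstract prediction-correction estimates -/

section Iteration

variable {H : Type*} [NormedAddCommGroup H] [InnerProductSpace ℝ H] {A D G : W H →L[ℝ] W H}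

theorem normSq_sub (hA : ∀ x y, inner ℝ (A x) y = inner ℝ (A y) x) (x y : W H) :
    normSq A (x - y) = normSq A x - 2 * inner ℝ (A y) x + normSq A y := by
  simp only [normSq, map_sub, inner_sub_left, inner_sub_right, hA x y]
  ring

/-- Fejér monotonicity of the prediction-correction step. -/
theorem normSq_correction_le (hA : ∀ x y, inner ℝ (A x) y = inner ℝ (A y) x)
    (hAD : ∀ x, A (D x) = G x) {w w' z : W H} (h : 0 ≤ inner ℝ (G (w - w')) (w' - z)) :
    normSq A (w - D (w - w') - z) ≤ normSq A (w - z)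
      - (2 * inner ℝ (G (w - w')) (w - w') - normSq A (D (w - w'))) := by
  rw [sub_right_comm, normSq_sub hA, hAD]
  -- Expanding the square leaves `-2 (G e, w - z)` with `e = w - w'`, and the hypothesis bounds `(G
  -- e, w - z)` below by `(G e, e)`.
  have : w' - z = (w - z) - (w - w') := by abel
  rw [this, inner_sub_right] at h
  linarith

/-- The residual of the next step is at most that of the current one. -/
theorem normSq_residual_le (hA : ∀ x y, inner ℝ (A x) y = inner ℝ (A y) x)
    (hAD : ∀ x, A (D x) = G x)
    (hN : ∀ e, 0 ≤ 2 * inner ℝ (G e) e - normSq A (D e)) {w₀ w₀' w₁ w₁' : W H}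
    (hw : w₁ = w₀ - D (w₀ - w₀'))
    (h : 0 ≤ inner ℝ (G ((w₀ - w₀') - (w₁ - w₁'))) (w₀' - w₁')) :
    normSq A (D (w₁ - w₁')) ≤ normSq A (D (w₀ - w₀')) := by
  -- With `a` the change of the error, `h` becomes `(G a, 𝓓 e₀) ≥ (G a, a)`, where `e₀ = w₀ - w₀'`;
  -- expanding `‖𝓓 (e₀ - a)‖²` then leaves the form of `hN` at `a`.
  set a := (w₀ - w₀') - (w₁ - w₁') with ha
  have h1 : w₁ - w₁' = (w₀ - w₀') - a := by rw [ha]; abel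
  have h2 : w₀' - w₁' = D (w₀ - w₀') - a := by
    have : D (w₀ - w₀') = w₀ - w₁ := by rw [hw]; abel
    rw [this, ha]; abel
  rw [h2, inner_sub_right] at h
  rw [h1, map_sub, normSq_sub hA, hAD]
  linarith [hN a]

/-- An antitone sequence whose partial sums are controlled decays like `1 / (K + 1)`. -/
theorem le_of_telescoping {a b : ℕ → ℝ} {c : ℝ} (hc : 0 < c) (ha : Antitone a)
    (hb : ∀ k, 0 ≤ b k) (h : ∀ k, b (k + 1) ≤ b k - c * a k) (K : ℕ) :
    a K ≤ 1 / (c * (K + 1)) * b 0 := by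
  -- Each of the `K + 1` terms `a 0, …, a K` is replaced by the smallest, `a K`.
  have hsum : ∀ n : ℕ, n ≤ K + 1 → n * (c * a K) + b n ≤ b 0 := by
    intro n
    induction n with
    | zero => simp
    | succ n ih =>
      intro hn
      have := mul_le_mul_of_nonneg_left (ha (show n ≤ K by omega)) hc.le
      push_cast
      linarith [ih (by omega), h n]
  have h1 := hsum (K + 1) le_rfl
  have h2 := hb (K + 1)
  rw [one_div_mul_eq_div, le_div_iff₀ (by positivity)]
  push_cast at h1
  linarith

end Iteration

/-! ### Convexity of the functionals and the proximal inequality -/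

section Convexity

variable {N : ℕ} {Ω : Set (Space N)}

theorem integral_mul_eq_inner (u p : L2 Ω) : ∫ x in Ω, p x * u x = inner ℝ u p := by
  rw [L2.inner_def]
  exact integral_congr_ae (ae_of_all _ fun x => by simp)

theorem integral_sq_abs_eq (u : L2 Ω) : ∫ x in Ω, |u x| ^ 2 = ‖u‖ ^ 2 := by
  rw [← real_inner_self_eq_norm_sq, ← integral_mul_eq_inner]
  exact integral_congr_ae (ae_of_all _ fun x => by simp [sq])

theorem fidelity_eq (uT q : L2 Ω) : fidelity uT q = 1 / 2 * ‖q - uT‖ ^ 2 := by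
  rw [fidelity, ← integral_sq_abs_eq]
  congr 1
  refine integral_congr_ae ?_
  filter_upwards [Lp.coeFn_sub q uT] with x hx
  rw [hx, Pi.sub_apply]

/-- Completing the square shows that the supremum is attained at `q = uT + p`. -/
theorem fidelityConj_eq (uT p : L2 Ω) :
    fidelityConj uT p = inner ℝ uT p + 1 / 2 * ‖p‖ ^ 2 := by
  have hval : ∀ q : L2 Ω, (∫ x in Ω, p x * q x) - fidelity uT q =
      inner ℝ uT p + 1 / 2 * ‖p‖ ^ 2 - 1 / 2 * ‖q - uT - p‖ ^ 2 := fun q => by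
    rw [integral_mul_eq_inner, fidelity_eq, norm_sub_sq_real (q - uT), inner_sub_left]
    ring
  simp only [fidelityConj, hval]
  have hle : ∀ q : L2 Ω, inner ℝ uT p + 1 / 2 * ‖p‖ ^ 2 - 1 / 2 * ‖q - uT - p‖ ^ 2 ≤
      inner ℝ uT p + 1 / 2 * ‖p‖ ^ 2 := fun q => by nlinarith [sq_nonneg ‖q - uT - p‖]
  refine le_antisymm (ciSup_le hle) ?_
  refine le_ciSup_of_le ⟨_, Set.forall_mem_range.2 hle⟩ (uT + p) ?_
  simp

theorem convexOn_fidelityConj (uT : L2 Ω) : ConvexOn ℝ Set.univ (fidelityConj uT) := by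
  have h : fidelityConj uT = fun p => inner ℝ uT p + 1 / 2 * ‖p‖ ^ 2 :=
    funext (fidelityConj_eq uT)
  rw [h]
  refine ConvexOn.add ((innerSL ℝ uT).toLinearMap.convexOn convex_univ) ?_
  exact ((convexOn_norm convex_univ).pow (fun _ _ => norm_nonneg _) 2).smul (by norm_num)

theorem convexOn_integral_abs (hΩ : Bornology.IsBounded Ω) :
    ConvexOn ℝ Set.univ (fun u : L2 Ω => ∫ x in Ω, |u x|) := by
  -- Boundedness of `Ω` gives `L² ⊆ L¹`, so no integral of `|u|` takes the default value `0`.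
  have : IsFiniteMeasure ((volume : Measure (Space N)).restrict Ω) :=
    ⟨by simpa using hΩ.measure_lt_top⟩
  have hint : ∀ u : L2 Ω, Integrable (fun x => |u x|) (volume.restrict Ω) := fun u =>
    ((Lp.memLp u).integrable (by norm_num)).abs
  refine ⟨convex_univ, fun u _ z _ a b ha hb _ => ?_⟩
  simp only [smul_eq_mul]
  rw [← integral_const_mul, ← integral_const_mul,
    ← integral_add ((hint u).const_mul a) ((hint z).const_mul b)]
  refine integral_mono_ae (hint _) (((hint u).const_mul a).add ((hint z).const_mul b)) ?_
  filter_upwards [Lp.coeFn_add (a • u) (b • z), Lp.coeFn_smul a u, Lp.coeFn_smul b z]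
    with x h1 h2 h3
  simp only [h1, Pi.add_apply, h2, h3, Pi.smul_apply, smul_eq_mul]
  refine (abs_add_le _ _).trans_eq ?_
  rw [abs_mul, abs_mul, abs_of_nonneg ha, abs_of_nonneg hb]

theorem convexOn_regularizer (hΩ : Bornology.IsBounded Ω) {τ β : ℝ} (hτ : 0 ≤ τ) (hβ : 0 ≤ β) :
    ConvexOn ℝ Set.univ (regularizer (Ω := Ω) τ β) := by
  have h : regularizer (Ω := Ω) τ β = fun u => τ / 2 * ‖u‖ ^ 2 + β * ∫ x in Ω, |u x| :=
    funext fun u => by rw [regularizer, integral_sq_abs_eq]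
  rw [h]
  exact (((convexOn_norm convex_univ).pow (fun _ _ => norm_nonneg _) 2).smul
    (by positivity)).add ((convexOn_integral_abs hΩ).smul hβ)

/-- The variational inequality of a proximal step. -/
theorem variational_of_isMinOn {H : Type*} [NormedAddCommGroup H]
    [InnerProductSpace ℝ H] {h : H → ℝ} (hh : ConvexOn ℝ Set.univ h) {a y x : H} {c : ℝ}
    (hx : IsMinOn (fun z => h z + inner ℝ a z + 1 / (2 * c) * ‖z - y‖ ^ 2) Set.univ x) (z : H) :
    0 ≤ h z - h x + inner ℝ (a + (1 / c) • (x - y)) (z - x) := by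
  -- The minimizer is compared with `x + t • (z - x)` and the result divided by `t`; the quadratic
  -- remainder vanishes as `t → 0`.
  have key : ∀ t : ℝ, 0 < t → t ≤ 1 →
      0 ≤ h z - h x + inner ℝ (a + (1 / c) • (x - y)) (z - x)
        + t * (1 / (2 * c) * ‖z - x‖ ^ 2) := by
    intro t ht ht1
    have h1 := isMinOn_iff.1 hx (x + t • (z - x)) (Set.mem_univ _)
    have h2 : h (x + t • (z - x)) ≤ (1 - t) * h x + t * h z := by
      have := hh.2 (Set.mem_univ x) (Set.mem_univ z) (sub_nonneg.2 ht1) ht.le (by ring)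
      rwa [smul_eq_mul, smul_eq_mul,
        show (1 - t) • x + t • z = x + t • (z - x) by module] at this
    have h3 : x + t • (z - x) - y = (x - y) + t • (z - x) := by abel
    simp only [h3, norm_add_sq_real, inner_add_right, inner_smul_right, norm_smul, mul_pow,
      Real.norm_eq_abs, sq_abs] at h1
    rw [inner_add_left, inner_smul_left, conj_trivial]
    refine nonneg_of_mul_nonneg_right (a := t) ?_ ht
    have h4 : 1 / (2 * c) * (2 * (t * inner ℝ (x - y) (z - x))) =
        t * (1 / c * inner ℝ (x - y) (z - x)) := by
      field_simp
    linarith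
  have hlim : Tendsto (fun t : ℝ => h z - h x + inner ℝ (a + (1 / c) • (x - y)) (z - x)
      + t * (1 / (2 * c) * ‖z - x‖ ^ 2)) (𝓝[>] 0)
      (𝓝 (h z - h x + inner ℝ (a + (1 / c) • (x - y)) (z - x)
        + 0 * (1 / (2 * c) * ‖z - x‖ ^ 2))) :=
    (by fun_prop : Continuous fun t : ℝ => h z - h x + inner ℝ (a + (1 / c) • (x - y)) (z - x)
      + t * (1 / (2 * c) * ‖z - x‖ ^ 2)).continuousWithinAt
  rw [zero_mul, add_zero] at hlim
  refine ge_of_tendsto hlim ?_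
  filter_upwards [Ioc_mem_nhdsGT (zero_lt_one' ℝ)] with t ht using key t ht.1 ht.2

end Convexity

/-! ### Variational inequalities along the algorithm -/

section VariationalInequality

variable {N : ℕ} {Ω : Set (Space N)} {L : L2 Ω →L[ℝ] L2 Ω} {τ β θ r s ρ σ : ℝ}
  {uT us ps : L2 Ω} {u p u' p' : ℕ → L2 Ω}

/-- The variational inequality satisfied by the predictor. -/
theorem IsGenerated.variational (hΩ : Bornology.IsBounded Ω) (hτ : 0 ≤ τ) (hβ : 0 ≤ β)
    (h : IsGenerated L τ β uT θ r s ρ σ u p u' p') (k : ℕ) (z q : L2 Ω) :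
    inner ℝ (opG L θ r s (pair (u k) (p k) - pair (u' k) (p' k))) (pair z q - pair (u' k) (p' k)) ≤
      regularizer τ β z - regularizer τ β (u' k) + fidelityConj uT q - fidelityConj uT (p' k)
        + inner ℝ (L z) (p' k) - inner ℝ (L (u' k)) q := by
  have hu := variational_of_isMinOn (convexOn_regularizer hΩ hτ hβ)
    (a := ContinuousLinearMap.adjoint L (p k)) (y := u k) (x := u' k) (c := r) (by
      simpa only [integral_mul_eq_inner, ContinuousLinearMap.adjoint_inner_left,
        real_inner_comm (p k)] using h.predict_u k) z
  have hp := variational_of_isMinOn (convexOn_fidelityConj uT)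
    (a := -L (u' k + θ • (u' k - u k))) (y := p k) (x := p' k) (c := s) (by
      refine isMinOn_iff.2 fun q hq => ?_
      have h1 := isMaxOn_iff.1 (h.predict_p k) q hq
      simp only [integral_mul_eq_inner] at h1
      simp only [inner_neg_left]
      linarith) q
  -- Splitting `p k = p' k + (p k - p' k)` in the primal step yields the block `-𝓛*` of `G`, and the
  -- extrapolation in the dual step yields `-θ𝓛`; what remains is the coupling at the predictor.
  rw [pair_sub, pair_sub, inner_opG_pair]
  simp only [inner_add_left, inner_smul_left, inner_neg_left, conj_trivial, map_sub, map_add,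
    map_smul, inner_sub_left, inner_sub_right, ContinuousLinearMap.adjoint_inner_left] at hu hp ⊢
  simp only [real_inner_comm (L _)] at hu hp ⊢
  linarith

/-- At `(us, ps)` the upper bound in `IsGenerated.variational` is the Lagrangian at `(us, p' k)`
minus that at `(u' k, ps)`, which is nonpositive at a saddle point. -/
theorem IsGenerated.inner_saddle_nonneg (hΩ : Bornology.IsBounded Ω) (hτ : 0 ≤ τ) (hβ : 0 ≤ β)
    (h : IsGenerated L τ β uT θ r s ρ σ u p u' p') (hs : IsSaddleSolution L τ β uT us ps) (k : ℕ) :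
    0 ≤ inner ℝ (opG L θ r s (pair (u k) (p k) - pair (u' k) (p' k)))
      (pair (u' k) (p' k) - pair us ps) := by
  have h1 := h.variational hΩ hτ hβ k us ps
  have h2 := hs (u' k) (Set.mem_univ _) (p' k) (Set.mem_univ _)
  simp only [lagrangian, integral_mul_eq_inner] at h2
  rw [← neg_sub (pair us ps), inner_neg_right]
  linarith

/-- When the two inequalities are added, all function values and coupling terms cancel. -/
theorem IsGenerated.inner_succ_nonneg (hΩ : Bornology.IsBounded Ω) (hτ : 0 ≤ τ) (hβ : 0 ≤ β)
    (h : IsGenerated L τ β uT θ r s ρ σ u p u' p') (k : ℕ) :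
    0 ≤ inner ℝ (opG L θ r s ((pair (u k) (p k) - pair (u' k) (p' k)) -
        (pair (u (k + 1)) (p (k + 1)) - pair (u' (k + 1)) (p' (k + 1)))))
      (pair (u' k) (p' k) - pair (u' (k + 1)) (p' (k + 1))) := by
  have h1 := h.variational hΩ hτ hβ k (u' (k + 1)) (p' (k + 1))
  have h2 := h.variational hΩ hτ hβ (k + 1) (u' k) (p' k)
  rw [← neg_sub (pair (u' k) (p' k)) (pair (u' (k + 1)) (p' (k + 1))), inner_neg_right] at h1
  rw [map_sub, inner_sub_left]
  linarith

theorem IsGenerated.correction (h : IsGenerated L τ β uT θ r s ρ σ u p u' p') (k : ℕ) :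
    pair (u (k + 1)) (p (k + 1)) = pair (u k) (p k) -
      opD (L2 Ω) ρ σ (pair (u k) (p k) - pair (u' k) (p' k)) := by
  rw [pair_sub, opD_pair, pair_sub, h.correct_u, h.correct_p]

end VariationalInequality

end SourceId

/-! ### The convergence rate -/

theorem mainTheorem4 (N : ℕ) (hN : 1 ≤ N) (Ω : Set (SourceId.Space N))
    (hΩ_open : IsOpen Ω) (hΩ_conn : IsConnected Ω) (hΩ_bdd : Bornology.IsBounded Ω)
    (d : ℝ) (hd : 0 < d) (v : SourceId.Space N) (T : ℝ) (hT : 0 < T)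
    (θ r s ρ σ : ℝ)
    (hparam : SourceId.Admissible (SourceId.solutionOperator Ω d v T) θ r s ρ σ) :
    ∃ c₀ : ℝ, 0 < c₀ ∧
      ∀ (τ : ℝ) (_ : 0 < τ) (β : ℝ) (_ : 0 < β) (uT us ps : SourceId.L2 Ω)
        (u p u' p' : ℕ → SourceId.L2 Ω),
        SourceId.IsSaddleSolution (SourceId.solutionOperator Ω d v T) τ β uT us ps →
        SourceId.IsGenerated (SourceId.solutionOperator Ω d v T) τ β uT θ r s ρ σ u p u' p' →
        Antitone (fun K : ℕ => SourceId.residual (SourceId.solutionOperator Ω d v T) θ r s ρ σ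
          (u K) (p K) (u' K) (p' K)) ∧
        (∀ K : ℕ, SourceId.residual (SourceId.solutionOperator Ω d v T) θ r s ρ σ
            (u K) (p K) (u' K) (p' K)
          ≤ 1 / (c₀ * (K + 1)) *
            SourceId.normSq (SourceId.opK (SourceId.solutionOperator Ω d v T) θ r s ρ σ)
              (SourceId.pair (u 0) (p 0) - SourceId.pair us ps)) ∧
        (fun K : ℕ => SourceId.residual (SourceId.solutionOperator Ω d v T) θ r s ρ σ
            (u K) (p K) (u' K) (p' K)) =O[atTop] (fun K : ℕ => 1 / (K : ℝ)) := by
  obtain ⟨c, hc, hcon⟩ := hparam.exists_contraction_constant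
  obtain ⟨hρ, hσ, hθσ, -, -, -⟩ := hparam.relaxation
  have hpos := hparam.normSq_opK_nonneg
  -- From here on only the boundedness and linearity of the operator matter, not the equation behind
  -- it.
  generalize SourceId.solutionOperator Ω d v T = L at *
  have hsymm := SourceId.inner_opK_comm L (r := r) (s := s) hρ.ne' hσ.ne' hθσ
  have hcomp := SourceId.opK_comp_opD L θ r s hρ.ne' hσ.ne'
  refine ⟨c, hc, fun τ hτ β hβ uT us ps u p u' p' hsad hgen => ?_⟩
  have hanti : Antitone (fun K : ℕ => SourceId.residual L θ r s ρ σ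
      (u K) (p K) (u' K) (p' K)) :=
    antitone_nat_of_succ_le fun k => SourceId.normSq_residual_le hsymm hcomp
      (fun e => (mul_nonneg hc.le (hpos _)).trans (hcon e)) (hgen.correction k)
      (hgen.inner_succ_nonneg hΩ_bdd hτ.le hβ.le k)
  have hbound := SourceId.le_of_telescoping hc hanti
    (b := fun k => SourceId.normSq (SourceId.opK L θ r s ρ σ)
      (SourceId.pair (u k) (p k) - SourceId.pair us ps)) (fun _ => hpos _) (fun k => by
        have h1 := SourceId.normSq_correction_le hsymm hcomp
          (hgen.inner_saddle_nonneg hΩ_bdd hτ.le hβ.le hsad k)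
        rw [← hgen.correction k] at h1
        exact h1.trans (sub_le_sub_left (hcon _) _))
  refine ⟨hanti, hbound, ?_⟩
  set B := SourceId.normSq (SourceId.opK L θ r s ρ σ)
    (SourceId.pair (u 0) (p 0) - SourceId.pair us ps) with hB
  refine Asymptotics.IsBigO.of_bound (B / c) ?_
  -- `K = 0` is excluded since `1 / K` is then `0` by convention.
  filter_upwards [eventually_gt_atTop 0] with K hK
  have hK' : (0 : ℝ) < K := Nat.cast_pos.2 hK
  rw [Real.norm_of_nonneg (show 0 ≤ SourceId.residual L θ r s ρ σ _ _ _ _ from hpos _),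
    Real.norm_of_nonneg (by positivity)]
  refine (hbound K).trans ?_
  have hB0 : 0 ≤ B := hpos _
  calc 1 / (c * (K + 1)) * B ≤ 1 / (c * K) * B := by gcongr; linarith
    _ = B / c * (1 / K) := by field_simp
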